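/- **Theorem (Hausdorff consistency).** Let $S\in\{0,1\}$ and let $Z_1,Z_2$ be random vectors in $\mathbb{R}^d$, where $Z_2$ is observed only if $S=1$; the observed vector is $W=(S,Z_1,SZ_2)$ and $W_1,W_2,\dots$ are i.i.d. copies of it, $W_i=(s_i,z_{i1},s_iz_{i2})$. Let $p=P(S=1)\in(0,1)$, let $\pi$ be the distribution of $(Z_1,Z_2)$, $\pi^1$ its conditional distribution given $S=1$, and $\pi^0_1$ the conditional distribution of $Z_1$ given $S=0$. Let $\mu$ be a probability measure on $\mathcal Z_1\times\mathcal Z_2$, where $\mathcal Z_1,\mathcal Z_2\subset\mathbb{R}^d$; let $\mathcal P$ be the set of probability measures absolutely continuous with respect to $\mu$, and let $\Pi^0$ be the set of $\pi^0\in\mathcal P$ with first marginal $\pi^0_1$. For $\Theta\subset\mathbb{R}^{d_\theta}$ and a moment function $\phi$ with values in $\mathbb{R}^{d_\phi}$ put $$\nu_{\pi^0}(\theta)=p\,\mathbb{E}_{\pi^1}[\phi(Z_1,Z_2,\theta)]+(1-p)\,\mathbb{E}_{\pi^0}[\phi(Z_1,Z_2,\theta)],\qquad N(\theta)=\{\nu_{\pi^0}(\theta):\pi^0\in\Pi^0\},$$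 $$\Theta_I=\{\theta\in\Theta:\ \exists\,\pi^0\in\Pi^0,\ \nu_{\pi^0}(\theta)=0\},\qquad \psi_{N(\theta)}(u)=\sup_{\nu\in N(\theta)}u'\nu,\qquad Q(\theta)=\inf_{\|u\|\le1}\psi_{N(\theta)}(u),$$ $$\hat\psi_{N(\theta)}(u)=\frac1n\sum_{i=1}^n\Big(s_iu'\phi(z_{i1},z_{i2},\theta)+(1-s_i)\max_{z_2\in\mathcal Z_2}u'\phi(z_{i1},z_2,\theta)\Big),\qquad \hat Q(\theta)=\inf_{\|u\|\le1}\hat\psi_{N(\theta)}(u),$$ and $\hat\Theta_I=\{\theta\in\Theta:\hat Q(\theta)\ge-\eta_n\}$ with $\eta_n>0$. Suppose that: 1. $\Theta$, $\mathcal Z_1$ and $\mathcal Z_2$ are compact; $\pi\in\mathcal P$; for each $\theta\in\Theta$ the map $(z_1,z_2)\mapsto\phi(z_1,z_2,\theta)$ is continuous on $\mathcal Z_1\times\mathcal Z_2$; and for each $\rho\in\mathcal P$ the map $\theta\mapsto\mathbb{E}_\rho[\phi(Z_1,Z_2,\theta)]$ is continuous on $\Theta$. 2. For $\mu_1$-almost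 every $z_1$ ($\mu_1$ being the first marginal of $\mu$), the regular conditional distribution $\mu(dz_2\mid z_1)$ gives positive mass to every open set that meets $\mathcal Z_2$. 3. There is a function $L$ with $\mathbb{E}\,L(Z_1)^2<\infty$ such that, almost surely in $Z_1$, $\sup_{z_2\in\mathcal Z_2}\|\phi(Z_1,z_2,\theta_1)-\phi(Z_1,z_2,\theta_2)\|\le L(Z_1)\|\theta_1-\theta_2\|$ for all $\theta_1,\theta_2\in\Theta$. 4. $\Theta_I\neq\emptyset$ (as is the case when $\mathbb{E}_\pi[\phi(Z_1,Z_2,\theta)]=0$ for some $\theta\in\Theta$). 5. There is a weakly increasing $m:\mathbb{R}_+\to\mathbb{R}_+$ with $m(0)=0$ and $m(\delta)>0$ for $\delta>0$ such that $Q(\theta)\le-m(d(\theta,\Theta_I))$ for all $\theta\in\Theta$, where $d(\theta,A)=\inf_{a\in A}\|a-\theta\|$. 6. $\eta_n\to0$ and $n^{-1/2}=o(\eta_n)$. Then $d_H(\Theta_I,\hat\Theta_I)=o_p(1)$, where $d_H(A,B)=\max\{\sup_{a\in A}d(a,B),\sup_{b\in B}d(b,A)\}$: for every $\varepsilon>0$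 the (outer) probability that $d_H(\Theta_I,\hat\Theta_I)\ge\varepsilon$ tends to $0$ as $n\to\infty$. (Here $d_H=+\infty$ if exactly one of the two sets is empty.) -/

import Mathlib

open MeasureTheory ProbabilityTheory Filter Topology Asymptotics
open scoped ENNReal NNReal RealInnerProductSpace

/-- Euclidean space `ℝᵏ`. -/
abbrev Euc (k : ℕ) : Type := EuclideanSpace ℝ (Fin k)

/-- The data of a moment condition model in which `Z₂` may be missing: the sets `𝒵₁`, `𝒵₂`, the
dominating probability measure `μ`, the parameter space `Θ`, the moment function `φ`, and the
population law of the complete vector `(S, Z₁, Z₂)`, where `S = true` means that `Z₂` is observed.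
-/
structure MissingGMM (d dθ dφ : ℕ) where
  Z1 : Set (Euc d)
  Z2 : Set (Euc d)
  μ : Measure (Euc d × Euc d)
  probμ : IsProbabilityMeasure μ
  Θ : Set (Euc dθ)
  φ : Euc d → Euc d → Euc dθ → Euc dφ
  law : Measure (Bool × Euc d × Euc d)
  problaw : IsProbabilityMeasure law

attribute [instance] MissingGMM.probμ MissingGMM.problaw

/-- The observed part `W = (S, Z₁, S Z₂)` of the complete vector `(S, Z₁, Z₂)`. -/
noncomputable def observe {d : ℕ} (x : Bool × Euc d × Euc d) : Bool × Euc d × Euc d :=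
  (x.1, x.2.1, if x.1 then x.2.2 else 0)

namespace MissingGMM

noncomputable section

variable {d dθ dφ : ℕ} (M : MissingGMM d dθ dφ)

/-- The law of the observed vector `W = (S, Z₁, S Z₂)`. -/
def observedLaw : Measure (Bool × Euc d × Euc d) := M.law.map observe

/-- The distribution `π` of `(Z₁, Z₂)`. -/
def jointDist : Measure (Euc d × Euc d) := M.law.map Prod.snd

/-- The selection probability `p = P(S = 1)`. -/
def selProb : ℝ := M.law.real {x | x.1 = true}

/-- The conditional distribution of `(Z₁, Z₂)` given `S = s`. -/
def distGiven (s : Bool) : Measure (Euc d × Euc d) :=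
  (ProbabilityTheory.cond M.law {x | x.1 = s}).map Prod.snd

/-- The set `𝒫(𝒵₁ × 𝒵₂)` of probability distributions that are absolutely continuous with
respect to `μ`. -/
def dominated : Set (Measure (Euc d × Euc d)) :=
  {ρ | IsProbabilityMeasure ρ ∧ ρ ≪ M.μ}

/-- The identified set `Π⁰` for the distribution of `(Z₁, Z₂)` given `S = 0`: the dominated
distributions whose first marginal is the distribution of `Z₁` given `S = 0`. -/
def missingDists : Set (Measure (Euc d × Euc d)) :=
  {ρ | ρ ∈ M.dominated ∧ ρ.fst = (M.distGiven false).fst}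

/-- The moment `𝔼_ρ[φ(Z₁, Z₂, θ)]`. -/
def moment (ρ : Measure (Euc d × Euc d)) (θ : Euc dθ) : Euc dφ :=
  ∫ z, M.φ z.1 z.2 θ ∂ρ

/-- `ν_ρ(θ) = p 𝔼_{π¹}[φ(Z₁, Z₂, θ)] + (1 - p) 𝔼_ρ[φ(Z₁, Z₂, θ)]`. -/
def prediction (ρ : Measure (Euc d × Euc d)) (θ : Euc dθ) : Euc dφ :=
  M.selProb • M.moment (M.distGiven true) θ + (1 - M.selProb) • M.moment ρ θ

/-- The sharp identified set `Θ_I`. -/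
def identifiedSet : Set (Euc dθ) :=
  {θ | θ ∈ M.Θ ∧ ∃ ρ ∈ M.missingDists, M.prediction ρ θ = 0}

/-- The set of moment predictions `N(θ)`. -/
def predictions (θ : Euc dθ) : Set (Euc dφ) :=
  {ν | ∃ ρ ∈ M.missingDists, M.prediction ρ θ = ν}

/-- The support function `ψ_{N(θ)}(u)`. -/
def supportFn (θ : Euc dθ) (u : Euc dφ) : ℝ :=
  sSup ((fun ν => ⟪u, ν⟫) '' M.predictions θ)

/-- The criterion function `Q(θ)`, the infimum over the closed unit ball of the support
function. -/
def criterion (θ : Euc dθ) : ℝ :=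
  sInf (M.supportFn θ '' Metric.closedBall 0 1)

/-- The contribution of one observation `w = (s, z₁, s z₂)` to the sample support function:
`s u'φ(z₁, s z₂, θ) + (1 - s) max_{z₂ ∈ 𝒵₂} u'φ(z₁, z₂, θ)`. -/
def score (θ : Euc dθ) (u : Euc dφ) (w : Bool × Euc d × Euc d) : ℝ :=
  if w.1 then ⟪u, M.φ w.2.1 w.2.2 θ⟫
  else sSup ((fun z₂ => ⟪u, M.φ w.2.1 z₂ θ⟫) '' M.Z2)

/-- The sample support function computed from the first `n` observations. -/
def sampleSupportFn (n : ℕ) (w : ℕ → Bool × Euc d × Euc d) (θ : Euc dθ) (u : Euc dφ) : ℝ :=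
  (1 / (n : ℝ)) * ∑ i ∈ Finset.range n, M.score θ u (w i)

/-- The sample criterion function computed from the first `n` observations. -/
def sampleCriterion (n : ℕ) (w : ℕ → Bool × Euc d × Euc d) (θ : Euc dθ) : ℝ :=
  sInf (M.sampleSupportFn n w θ '' Metric.closedBall 0 1)

/-- The set estimator `{θ ∈ Θ : Q̂(θ) ≥ -η}`. -/
def estimator (n : ℕ) (w : ℕ → Bool × Euc d × Euc d) (η : ℝ) : Set (Euc dθ) :=
  {θ | θ ∈ M.Θ ∧ -η ≤ M.sampleCriterion n w θ}

/-- Compactness, dominance and continuity conditions. -/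
structure MomentAndSupport : Prop where
  Θ_compact : IsCompact M.Θ
  Z1_compact : IsCompact M.Z1
  Z2_compact : IsCompact M.Z2
  μ_support : M.μ (M.Z1 ×ˢ M.Z2)ᶜ = 0
  jointDist_dominated : M.jointDist ∈ M.dominated
  φ_continuous : ∀ θ ∈ M.Θ, ContinuousOn (fun z : Euc d × Euc d => M.φ z.1 z.2 θ) (M.Z1 ×ˢ M.Z2)
  moment_continuous : ∀ ρ ∈ M.dominated, ContinuousOn (M.moment ρ) M.Θ

/-- The regular conditional distribution `μ(dz₂ | z₁)` gives positive mass to every nonempty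
relatively open subset of `𝒵₂`, for `μ₁`-almost every `z₁`. -/
def ConditionalFullSupport : Prop :=
  ∀ᵐ z₁ ∂M.μ.fst, ∀ U : Set (Euc d), IsOpen U → (U ∩ M.Z2).Nonempty →
    0 < M.μ.condKernel z₁ U

/-- The moment function is Lipschitz in the parameter, uniformly in `z₂ ∈ 𝒵₂`, with a constant
`L(Z₁)` that is square integrable under the distribution of `Z₁`. -/
def LipschitzMoments : Prop :=
  ∃ L : Euc d → ℝ, MemLp L 2 M.jointDist.fst ∧
    ∀ᵐ z₁ ∂M.jointDist.fst, ∀ z₂ ∈ M.Z2, ∀ θ₁ ∈ M.Θ, ∀ θ₂ ∈ M.Θ,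
      ‖M.φ z₁ z₂ θ₁ - M.φ z₁ z₂ θ₂‖ ≤ L z₁ * ‖θ₁ - θ₂‖

/-- Separation of the identified set in terms of the criterion function. -/
def Separation : Prop :=
  ∃ m : ℝ≥0 → ℝ≥0, Monotone m ∧ m 0 = 0 ∧ (∀ δ, 0 < δ → 0 < m δ) ∧
    ∀ θ ∈ M.Θ, M.criterion θ ≤ -(m (Metric.infNndist θ M.identifiedSet) : ℝ)

end

end MissingGMM

/-! The argument compares `supportFn` with the expectation of `score`. For `ρ ∈ missingDists` the
moment in direction `u` is at most the mean of the envelope, and the envelope depends on `z₁` alone,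
whose law is the same for all such `ρ`; hence the expected score dominates every `⟪u, prediction ρ
θ⟫` (`inner_prediction_le`). Conversely, full conditional support allows a `ρ` concentrated on
near-maximisers of `⟪u, φ⟫`, so the expected score is at most the support function
(`integral_score_le_supportFn`).

If the sample support function is within `η` of the expected score uniformly over `Θ` and the unit
ball, then on `identifiedSet` it is at least `-η`, so that set lies in the estimator, while on the
estimator the criterion is at least `-2η`. Separation turns the latter into closeness to
`identifiedSet` (`hausdorffEDist_estimator_le`).

It remains to bound the uniform deviation by `O_p(n^{-1/2})`. The score is almost surely Lipschitz
in the finite-dimensional pair `(θ, u)` with a square integrable constant, so chaining applies.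
Since only second moments are available, the maximal inequality comes from a second-order expansion
of `logSumExp`. It costs `log N` rather than `√(log N)` for `N` functions, which is harmless: `log
N` grows linearly along the nets while the radii decay geometrically
(`exists_measure_centredSum_le`). -/

/-! ### A maximal inequality for finite families of centred sums -/

section MaximalInequality

variable {ι : Type*} [Fintype ι]

/-- The function `x ↦ log ∑ₚ exp xₚ`. -/
noncomputable def logSumExp (x : ι → ℝ) : ℝ := Real.log (∑ p, Real.exp (x p))

/-- The gradient of `logSumExp`. -/
noncomputable def softmax (x : ι → ℝ) (p : ι) : ℝ := Real.exp (x p) / ∑ q, Real.exp (x q)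

theorem sum_exp_pos [Nonempty ι] (x : ι → ℝ) : 0 < ∑ p, Real.exp (x p) :=
  Finset.sum_pos (fun _ _ => Real.exp_pos _) Finset.univ_nonempty

theorem le_logSumExp (x : ι → ℝ) (p : ι) : x p ≤ logSumExp x := by
  have : Nonempty ι := ⟨p⟩
  rw [logSumExp, Real.le_log_iff_exp_le (sum_exp_pos x)]
  exact Finset.single_le_sum (f := fun p => Real.exp (x p)) (fun _ _ => (Real.exp_pos _).le)
    (Finset.mem_univ p)

theorem softmax_nonneg (x : ι → ℝ) (p : ι) : 0 ≤ softmax x p :=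
  div_nonneg (Real.exp_pos _).le (Finset.sum_nonneg fun _ _ => (Real.exp_pos _).le)

theorem sum_softmax [Nonempty ι] (x : ι → ℝ) : ∑ p, softmax x p = 1 := by
  simp only [softmax, ← Finset.sum_div]
  exact div_self (sum_exp_pos x).ne'

theorem softmax_le_one (x : ι → ℝ) (p : ι) : softmax x p ≤ 1 := by
  have : Nonempty ι := ⟨p⟩
  rw [← sum_softmax x]
  exact Finset.single_le_sum (fun q _ => softmax_nonneg x q) (Finset.mem_univ p)

/-- Exponential tilting: the increment is the log-moment of `b` under the probability weights
`softmax a`. -/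
theorem logSumExp_add [Nonempty ι] (a b : ι → ℝ) :
    logSumExp (a + b) = logSumExp a + Real.log (∑ p, softmax a p * Real.exp (b p)) := by
  have h : 0 < ∑ p, softmax a p * Real.exp (b p) :=
    Finset.sum_pos (fun p _ => mul_pos (div_pos (Real.exp_pos _) (sum_exp_pos a))
      (Real.exp_pos _)) Finset.univ_nonempty
  rw [logSumExp, logSumExp, ← Real.log_mul (sum_exp_pos a).ne' h.ne', Finset.mul_sum]
  congr 1
  refine Finset.sum_congr rfl fun p _ => ?_
  rw [softmax, Pi.add_apply, Real.exp_add]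
  field_simp [(sum_exp_pos a).ne']

theorem sum_softmax_mul_le [Nonempty ι] (a b : ι → ℝ) {β : ℝ} (hb : ∀ p, b p ≤ β) :
    ∑ p, softmax a p * b p ≤ β := by
  calc ∑ p, softmax a p * b p ≤ ∑ p, softmax a p * β :=
        Finset.sum_le_sum fun p _ => mul_le_mul_of_nonneg_left (hb p) (softmax_nonneg a p)
    _ = β := by rw [← Finset.sum_mul, sum_softmax, one_mul]

/-- Smoothness of `logSumExp` with respect to the maximum norm. -/
theorem logSumExp_add_le [Nonempty ι] (a b : ι → ℝ) {β : ℝ} (hb : ∀ p, |b p| ≤ β) :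
    logSumExp (a + b) ≤ logSumExp a + ∑ p, softmax a p * b p + 2 * β ^ 2 := by
  have hβ : 0 ≤ β := (abs_nonneg _).trans (hb (Classical.arbitrary ι))
  have hpos : 0 < ∑ p, softmax a p * Real.exp (b p) :=
    Finset.sum_pos (fun p _ => mul_pos (div_pos (Real.exp_pos _) (sum_exp_pos a))
      (Real.exp_pos _)) Finset.univ_nonempty
  rw [logSumExp_add, add_assoc]
  gcongr
  -- For `β ≤ 1`, `exp b ≤ 1 + b + b²` and `log x ≤ x - 1` leave a remainder `β²`. For `β > 1` the
  -- log term is at most `β` and the mean at least `-β`, and `2β ≤ 2β²`. Covering large `β` is what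
  -- lets the increments be merely square integrable.
  rcases le_or_gt β 1 with h1 | h1
  · have hle : ∑ p, softmax a p * (Real.exp (b p) - b p) ≤ 1 + β ^ 2 := by
      refine sum_softmax_mul_le a _ fun p => ?_
      have h2 := (le_abs_self _).trans (Real.abs_exp_sub_one_sub_id_le ((hb p).trans h1))
      have h3 : b p ^ 2 ≤ β ^ 2 := sq_le_sq' (abs_le.1 (hb p)).1 (abs_le.1 (hb p)).2
      linarith
    simp only [mul_sub, Finset.sum_sub_distrib] at hle
    have := Real.log_le_sub_one_of_pos hpos
    nlinarith
  · have h2 : Real.log (∑ p, softmax a p * Real.exp (b p)) ≤ β := by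
      rw [Real.log_le_iff_le_exp hpos]
      exact sum_softmax_mul_le a _ fun p => Real.exp_le_exp.2 ((le_abs_self _).trans (hb p))
    have h3 : ∑ p, softmax a p * (-b p) ≤ β :=
      sum_softmax_mul_le a _ fun p => (neg_le_abs _).trans (hb p)
    simp only [mul_neg, Finset.sum_neg_distrib] at h3
    nlinarith

theorem measurable_logSumExp : Measurable (logSumExp : (ι → ℝ) → ℝ) := by
  unfold logSumExp; fun_prop

theorem measurable_softmax (p : ι) : Measurable fun x : ι → ℝ => softmax x p := by
  unfold softmax; fun_prop

theorem abs_logSumExp_le [Nonempty ι] (x : ι → ℝ) :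
    |logSumExp x| ≤ Real.log (Fintype.card ι) + ∑ p, |x p| := by
  have hle : ∀ p, |x p| ≤ ∑ p, |x p| := fun p =>
    Finset.single_le_sum (f := fun p => |x p|) (fun _ _ => abs_nonneg _) (Finset.mem_univ p)
  have hlog : 0 ≤ Real.log (Fintype.card ι) := Real.log_natCast_nonneg _
  refine abs_le.2 ⟨?_, ?_⟩
  · have p := Classical.arbitrary ι
    have := le_logSumExp x p
    have := neg_le_of_abs_le (hle p)
    linarith
  · rw [logSumExp, Real.log_le_iff_le_exp (sum_exp_pos x), Real.exp_add,
      Real.exp_log (by exact_mod_cast Fintype.card_pos)]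
    calc ∑ p, Real.exp (x p) ≤ ∑ _p : ι, Real.exp (∑ p, |x p|) :=
          Finset.sum_le_sum fun p _ => Real.exp_le_exp.2 ((le_abs_self _).trans (hle p))
      _ = _ := by simp

variable {Ω : Type*} [MeasurableSpace Ω] {P : Measure Ω} [IsProbabilityMeasure P]

theorem integrable_of_integrable_sq {G : Ω → ℝ} {f : Ω → ℝ} (hG : Integrable (fun ω => G ω ^ 2) P)
    (hf : AEStronglyMeasurable f P) (hle : ∀ ω, |f ω| ≤ G ω) : Integrable f P := by
  refine ((integrable_const (1 : ℝ)).add hG).mono' hf (ae_of_all _ fun ω => ?_)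
  have := hle ω
  simp only [Real.norm_eq_abs, Pi.add_apply]
  nlinarith [sq_nonneg (G ω - 1), sq_nonneg (G ω)]

theorem integrable_logSumExp_comp [Nonempty ι] {X : Ω → ι → ℝ} (hX : Measurable X)
    (hint : ∀ p, Integrable (fun ω => X ω p) P) : Integrable (fun ω => logSumExp (X ω)) P :=
  ((integrable_const _).add (integrable_finsetSum _ fun p _ => (hint p).abs)).mono'
    (measurable_logSumExp.comp hX).aestronglyMeasurable
    (ae_of_all _ fun ω => abs_logSumExp_le (X ω))

/-- The expectation of `logSumExp` of a sum of independent centred vectors. -/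
theorem integral_logSumExp_sum_le [Nonempty ι] {Y : ℕ → Ω → ι → ℝ} (hYm : ∀ i, Measurable (Y i))
    (hindep : iIndepFun Y P) (hmean : ∀ i p, ∫ ω, Y i ω p ∂P = 0) {G : ℕ → Ω → ℝ}
    (hYG : ∀ i ω p, |Y i ω p| ≤ G i ω) (hG : ∀ i, Integrable (fun ω => G i ω ^ 2) P) {v : ℝ}
    (hGv : ∀ i, ∫ ω, G i ω ^ 2 ∂P ≤ v) (n : ℕ) :
    ∫ ω, logSumExp (∑ i ∈ Finset.range n, Y i ω) ∂P ≤
      Real.log (Fintype.card ι) + 2 * n * v := by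
  have hYint : ∀ i p, Integrable (fun ω => Y i ω p) P := fun i p =>
    integrable_of_integrable_sq (hG i) ((measurable_pi_apply p).comp (hYm i)).aestronglyMeasurable
      fun ω => hYG i ω p
  have hSm : ∀ n, Measurable fun ω => ∑ i ∈ Finset.range n, Y i ω := fun n =>
    Finset.measurable_sum _ fun i _ => hYm i
  have hlse : ∀ n, Integrable (fun ω => logSumExp (∑ i ∈ Finset.range n, Y i ω)) P := fun n => by
    refine integrable_logSumExp_comp (hSm n) fun p => ?_
    simp only [Finset.sum_apply]
    exact integrable_finsetSum _ fun i _ => hYint i p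
  induction n with
  | zero => simp [logSumExp]
  | succ n ih =>
    have hprod : ∀ p, Integrable
        (fun ω => softmax (∑ i ∈ Finset.range n, Y i ω) p * Y n ω p) P := fun p =>
      (hYint n p).bdd_mul (c := 1) ((measurable_softmax p).comp (hSm n)).aestronglyMeasurable
        (ae_of_all _ fun ω => by
          rw [Real.norm_eq_abs, abs_of_nonneg (softmax_nonneg _ _)]
          exact softmax_le_one _ _)
    -- The weights depend only on the first `n` summands, so the first-order term factors by
    -- independence and vanishes by centring.
    have hzero : ∀ p, ∫ ω, softmax (∑ i ∈ Finset.range n, Y i ω) p * Y n ω p ∂P = 0 := fun p => by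
      have hind : IndepFun (∑ i ∈ Finset.range n, Y i) (Y n) P :=
        hindep.indepFun_finsetSum_of_notMem hYm Finset.notMem_range_self
      have hind' := hind.comp (measurable_softmax p) (measurable_pi_apply (X := fun _ => ℝ) p)
      have hm : Measurable (∑ i ∈ Finset.range n, Y i) := by
        simpa only [Finset.sum_fn] using hSm n
      have := hind'.integral_fun_mul_eq_mul_integral
        ((measurable_softmax p).comp hm).aestronglyMeasurable
        ((measurable_pi_apply p).comp (hYm n)).aestronglyMeasurable
      simp only [Function.comp_apply, Finset.sum_apply, hmean, mul_zero] at this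
      exact this
    calc ∫ ω, logSumExp (∑ i ∈ Finset.range (n + 1), Y i ω) ∂P
        ≤ ∫ ω, (logSumExp (∑ i ∈ Finset.range n, Y i ω)
            + ∑ p, softmax (∑ i ∈ Finset.range n, Y i ω) p * Y n ω p + 2 * G n ω ^ 2) ∂P := by
          refine integral_mono (hlse _) (((hlse n).add
            (integrable_finsetSum _ fun p _ => hprod p)).add ((hG n).const_mul 2)) fun ω => ?_
          simp only [Finset.sum_range_succ]
          exact logSumExp_add_le _ _ (hYG n ω)
      _ = ∫ ω, logSumExp (∑ i ∈ Finset.range n, Y i ω) ∂P + 2 * ∫ ω, G n ω ^ 2 ∂P := by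
          have hsum := integrable_finsetSum Finset.univ fun p _ => hprod p
          have h1 := integral_add ((hlse n).add hsum) ((hG n).const_mul 2)
          have h2 := integral_add (hlse n) hsum
          have h3 := integral_finsetSum Finset.univ fun p _ => hprod p
          simp only [Pi.add_apply, hzero, Finset.sum_const_zero, integral_const_mul] at h1 h2 h3
          rw [h1, h2, h3, add_zero]
      _ ≤ _ := by
          push_cast
          linarith [hGv n]

/-- A maximal inequality for the sums of independent centred vectors. -/
theorem exists_integrable_bound_sum [Nonempty ι] {Y : ℕ → Ω → ι → ℝ}
    (hYm : ∀ i, Measurable (Y i))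
    (hindep : iIndepFun Y P) (hmean : ∀ i p, ∫ ω, Y i ω p ∂P = 0) {G : ℕ → Ω → ℝ}
    (hYG : ∀ i ω p, |Y i ω p| ≤ G i ω) (hG : ∀ i, Integrable (fun ω => G i ω ^ 2) P) {v : ℝ}
    (hGv : ∀ i, ∫ ω, G i ω ^ 2 ∂P ≤ v) (n : ℕ) {c : ℝ} (hc : 0 < c) :
    ∃ Φ : Ω → ℝ, Integrable Φ P ∧ (∀ ω p, |∑ i ∈ Finset.range n, Y i ω p| ≤ Φ ω) ∧
      ∫ ω, Φ ω ∂P ≤ (Real.log (2 * Fintype.card ι) + 2 * n * (c ^ 2 * v)) / c := by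
  -- Both signs are included to control absolute values; the scale `c` stays free, to be balanced
  -- against `n` later.
  set g : (ι → ℝ) → (ι × Bool → ℝ) := fun x q => if q.2 then c * x q.1 else -(c * x q.1) with hg
  have hgm : Measurable g := by
    refine measurable_pi_lambda _ fun q => ?_
    rcases q with ⟨p, _ | _⟩ <;> simp only [hg, if_true, Bool.false_eq_true, if_false] <;> fun_prop
  have hgadd : ∀ ω, (∑ i ∈ Finset.range n, g (Y i ω)) = g (fun p => ∑ i ∈ Finset.range n, Y i ω p)
      := fun ω => by
    ext ⟨p, _ | _⟩ <;> simp [hg, Finset.mul_sum]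
  have hgm' : ∀ i, Measurable fun ω => g (Y i ω) := fun i => hgm.comp (hYm i)
  have hYG' : ∀ i ω q, |g (Y i ω) q| ≤ c * G i ω := fun i ω q => by
    rcases q with ⟨p, _ | _⟩ <;> simpa [hg, abs_mul, abs_of_pos hc, hc] using hYG i ω p
  have hG' : ∀ i, Integrable (fun ω => (c * G i ω) ^ 2) P := fun i => by
    simpa only [mul_pow] using (hG i).const_mul (c ^ 2)
  have hYint : ∀ i q, Integrable (fun ω => g (Y i ω) q) P := fun i q =>
    integrable_of_integrable_sq (hG' i) ((measurable_pi_apply q).comp (hgm' i)).aestronglyMeasurable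
      fun ω => hYG' i ω q
  have key := integral_logSumExp_sum_le (P := P) (Y := fun i ω => g (Y i ω)) hgm'
    (hindep.comp (fun _ => g) fun _ => hgm) (fun i q => by
      rcases q with ⟨p, _ | _⟩ <;> simp [hg, integral_neg, integral_const_mul, hmean]) hYG' hG'
    (v := c ^ 2 * v) (fun i => by
      simp only [mul_pow, integral_const_mul]
      exact mul_le_mul_of_nonneg_left (hGv i) (sq_nonneg c)) n
  refine ⟨fun ω => logSumExp (∑ i ∈ Finset.range n, g (Y i ω)) / c, ?_, fun ω p => ?_, ?_⟩
  · refine (integrable_logSumExp_comp (Finset.measurable_sum _ fun i _ => hgm' i)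
      fun q => ?_).div_const c
    simp only [Finset.sum_apply]
    exact integrable_finsetSum _ fun i _ => hYint i q
  · rw [le_div_iff₀ hc, hgadd]
    have h1 := le_logSumExp (g fun p => ∑ i ∈ Finset.range n, Y i ω p) (p, true)
    have h2 := le_logSumExp (g fun p => ∑ i ∈ Finset.range n, Y i ω p) (p, false)
    simp only [hg, if_true, Bool.false_eq_true, if_false] at h1 h2
    rcases abs_cases (∑ i ∈ Finset.range n, Y i ω p) with h | h <;> rw [h.1] <;> linarith
  · rw [integral_div]
    gcongr
    simpa [mul_comm] using key

end MaximalInequality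

/-! ### A uniform deviation inequality for Lipschitz families -/

section Chaining

variable {E : Type*} [NormedAddCommGroup E] [NormedSpace ℝ E] [FiniteDimensional ℝ E]

/-- A closed ball of radius `R` is covered by exponentially many balls of radius `R / 2 ^ j`. -/
theorem exists_finset_cover_closedBall :
    ∃ C : ℕ, 1 ≤ C ∧ ∀ (x : E) {R : ℝ}, 0 < R → ∀ j : ℕ, ∃ A : Finset E, A.card ≤ C ^ j ∧
      ∀ t, ‖t - x‖ ≤ R → ∃ a ∈ A, ‖t - a‖ ≤ R / 2 ^ j := by
  classical
  obtain ⟨s, -, hsf, hs⟩ := (isCompact_closedBall (0 : E) 1).finite_cover_balls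
    (e := 1 / 2) (by norm_num)
  refine ⟨hsf.toFinset.card, Finset.card_pos.2 ?_, fun x R hR j => ?_⟩
  · have := hs (Metric.mem_closedBall_self zero_le_one)
    simp only [Set.mem_iUnion] at this
    obtain ⟨y, hy, -⟩ := this
    exact ⟨y, by simpa using hy⟩
  induction j with
  | zero => exact ⟨{x}, by simp, fun t ht => ⟨x, by simp, by simpa using ht⟩⟩
  | succ j ih =>
    obtain ⟨A, hA, hcov⟩ := ih
    have hr : 0 < R / 2 ^ j := by positivity
    refine ⟨Finset.image₂ (fun a y => a + (R / 2 ^ j) • y) A hsf.toFinset,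
      (Finset.card_image₂_le _ _ _).trans (by rw [pow_succ]; gcongr), fun t ht => ?_⟩
    obtain ⟨a, ha, hta⟩ := hcov t ht
    have hmem : (R / 2 ^ j)⁻¹ • (t - a) ∈ Metric.closedBall (0 : E) 1 := by
      rw [mem_closedBall_zero_iff, norm_smul, norm_inv, Real.norm_of_nonneg hr.le]
      exact inv_mul_le_one_of_le₀ hta hr.le
    have := hs hmem
    simp only [Set.mem_iUnion] at this
    obtain ⟨y, hy, hty⟩ := this
    refine ⟨a + (R / 2 ^ j) • y, Finset.mem_image₂_of_mem ha (by simpa using hy), ?_⟩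
    rw [Metric.mem_ball, dist_eq_norm] at hty
    have heq : t - (a + (R / 2 ^ j) • y) = (R / 2 ^ j) • ((R / 2 ^ j)⁻¹ • (t - a) - y) := by
      rw [smul_sub, smul_inv_smul₀ hr.ne']; abel
    rw [heq, norm_smul, Real.norm_of_nonneg hr.le, pow_succ, ← div_div, div_eq_mul_one_div _ (2 : ℝ)]
    exact mul_le_mul_of_nonneg_left hty.le hr.le

/-- A bounded set has nets of radius `R / 2 ^ j` with exponentially many points. -/
theorem exists_nets {T : Set E} (hT : Bornology.IsBounded T) {t₀ : E} (ht₀ : t₀ ∈ T) :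
    ∃ (R : ℝ) (C : ℕ) (N : ℕ → Finset E), 0 < R ∧ 1 ≤ C ∧ N 0 = {t₀} ∧ (∀ j, ↑(N j) ⊆ T) ∧
      (∀ j, (N j).card ≤ C ^ j) ∧ ∀ j, ∀ t ∈ T, ∃ b ∈ N j, ‖t - b‖ ≤ R / 2 ^ j := by
  classical
  obtain ⟨R, hR, hTR⟩ := hT.subset_closedBall_lt 0 t₀
  have hTR' : ∀ t ∈ T, ‖t - t₀‖ ≤ R := fun t ht => by
    simpa [dist_eq_norm] using hTR ht
  obtain ⟨C, hC, hcov⟩ := exists_finset_cover_closedBall (E := E)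
  have : ∀ j : ℕ, ∃ B : Finset E, (j = 0 → B = {t₀}) ∧ ↑B ⊆ T ∧ B.card ≤ C ^ j ∧
      ∀ t ∈ T, ∃ b ∈ B, ‖t - b‖ ≤ 2 * R / 2 ^ j := by
    intro j
    rcases Nat.eq_zero_or_pos j with rfl | hj
    · refine ⟨{t₀}, fun _ => rfl, by simpa using ht₀, by simp, fun t ht => ⟨t₀, by simp, ?_⟩⟩
      have := hTR' t ht
      simp only [pow_zero, div_one]
      linarith
    · obtain ⟨A, hA, hAc⟩ := hcov t₀ hR j
      -- The covering centres may lie outside `T`; replacing each by a nearby point of `T` doubles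
      -- the radius.
      have hr : ∀ a : E, ∃ b ∈ T, ∀ t ∈ T, ‖t - a‖ ≤ R / 2 ^ j → ‖b - a‖ ≤ R / 2 ^ j := fun a => by
        by_cases h : ∃ t ∈ T, ‖t - a‖ ≤ R / 2 ^ j
        · obtain ⟨b, hb, hba⟩ := h
          exact ⟨b, hb, fun _ _ _ => hba⟩
        · exact ⟨t₀, ht₀, fun t ht hta => (h ⟨t, ht, hta⟩).elim⟩
      choose r hrT hr using hr
      refine ⟨A.image r, fun h => absurd h hj.ne', ?_, Finset.card_image_le.trans hA,
        fun t ht => ?_⟩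
      · intro b hb
        obtain ⟨a, -, rfl⟩ := Finset.mem_image.1 (Finset.mem_coe.1 hb)
        exact hrT a
      · obtain ⟨a, ha, hta⟩ := hAc t (hTR' t ht)
        refine ⟨r a, Finset.mem_image_of_mem r ha, ?_⟩
        have := hr a t ht hta
        calc ‖t - r a‖ = ‖(t - a) - (r a - a)‖ := by congr 1; abel
          _ ≤ ‖t - a‖ + ‖r a - a‖ := norm_sub_le _ _
          _ ≤ 2 * R / 2 ^ j := by rw [mul_div_assoc]; linarith
  choose N h0 hNT hcard hN using this
  exact ⟨2 * R, C, N, by positivity, hC, h0 0 rfl, hNT, hcard, hN⟩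

variable {𝒳 : Type*} [MeasurableSpace 𝒳] {Q : Measure 𝒳} [IsProbabilityMeasure Q]
  {Ω : Type*} [MeasurableSpace Ω] {P : Measure Ω} [IsProbabilityMeasure P]

/-- The centred sum `∑_{i < n} (f(Xᵢ) - Q f)`. -/
noncomputable def centredSum (Q : Measure 𝒳) (X : ℕ → Ω → 𝒳) (f : 𝒳 → ℝ) (n : ℕ) (ω : Ω) : ℝ :=
  ∑ i ∈ Finset.range n, (f (X i ω) - ∫ x, f x ∂Q)

theorem integrable_sq_add_integral {F : 𝒳 → ℝ} (hF : MemLp F 2 Q) :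
    Integrable (fun x => (F x + ∫ y, F y ∂Q) ^ 2) Q :=
  (hF.add (memLp_const (∫ y, F y ∂Q))).integrable_sq

/-- A maximal inequality for the centred sums of a finite family of functions. -/
theorem exists_integrable_bound_centredSum {ι : Type*} [Fintype ι] [Nonempty ι] {X : ℕ → Ω → 𝒳}
    (hXm : ∀ i, Measurable (X i)) (hXi : iIndepFun X P) (hXl : ∀ i, P.map (X i) = Q)
    {h : ι → 𝒳 → ℝ} (hm : ∀ p, Measurable (h p)) {F : 𝒳 → ℝ} (hF : MemLp F 2 Q)
    {c : ℝ} (hc : 0 < c) (hle : ∀ p x, |h p x| ≤ c * F x) {n : ℕ} (hn : 0 < n) :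
    ∃ Φ : Ω → ℝ, Integrable Φ P ∧ (∀ ω p, |centredSum Q X (h p) n ω| ≤ Φ ω) ∧
      ∫ ω, Φ ω ∂P ≤ √n * (c * (Real.log (2 * Fintype.card ι)
        + 2 * ∫ x, (F x + ∫ y, F y ∂Q) ^ 2 ∂Q)) := by
  have hFint : Integrable F Q := hF.integrable one_le_two
  have hint : ∀ p, Integrable (h p) Q := fun p =>
    (hFint.const_mul c).mono' (hm p).aestronglyMeasurable (ae_of_all _ (hle p))
  have hg : Measurable fun x p => h p x - ∫ y, h p y ∂Q :=
    measurable_pi_lambda _ fun p => (hm p).sub_const _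
  have hsq := (integrable_sq_add_integral hF).const_mul (c ^ 2)
  have hmap : ∀ (i : ℕ) (g : 𝒳 → ℝ), AEStronglyMeasurable g Q →
      ∫ ω, g (X i ω) ∂P = ∫ x, g x ∂Q := fun i g hg => by
    rw [← hXl i] at hg ⊢
    exact (integral_map (hXm i).aemeasurable hg).symm
  have hGeq : ∀ i ω, (c * (F (X i ω) + ∫ y, F y ∂Q)) ^ 2 =
      (fun x => c ^ 2 * (F x + ∫ y, F y ∂Q) ^ 2) (X i ω) := fun i ω => mul_pow _ _ _
  have hs : 0 < √(n : ℝ) := Real.sqrt_pos.2 (by exact_mod_cast hn)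
  obtain ⟨Φ, hΦ, hb, hI⟩ := exists_integrable_bound_sum (P := P)
    (Y := fun i ω p => h p (X i ω) - ∫ y, h p y ∂Q) (fun i => hg.comp (hXm i))
    (hXi.comp (fun _ x p => h p x - ∫ y, h p y ∂Q) fun _ => hg)
    (fun i p => by
      rw [hmap i (fun x => h p x - ∫ y, h p y ∂Q) ((hm p).sub_const _).aestronglyMeasurable,
        integral_sub (hint p) (integrable_const _)]
      simp)
    (G := fun i ω => c * (F (X i ω) + ∫ y, F y ∂Q))
    (fun i ω p => by
      have h1 : |∫ y, h p y ∂Q| ≤ c * ∫ y, F y ∂Q := by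
        rw [← integral_const_mul]
        exact norm_integral_le_of_norm_le (f := h p) (hFint.const_mul c) (ae_of_all _ fun x => hle p x)
      calc _ ≤ |h p (X i ω)| + |∫ y, h p y ∂Q| := abs_sub _ _
        _ ≤ _ := by rw [mul_add]; exact add_le_add (hle p _) h1)
    (fun i => by
      simp only [hGeq]
      exact (MeasurePreserving.mk (hXm i) (hXl i)).integrable_comp_of_integrable hsq)
    (v := c ^ 2 * ∫ x, (F x + ∫ y, F y ∂Q) ^ 2 ∂Q)
    (fun i => by
      simp only [hGeq]
      rw [hmap i _ hsq.aestronglyMeasurable, integral_const_mul])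
    -- This scale makes the accumulated second-order term `2v`, independent of `n`, and leaves the
    -- factor `c√n` in front.
    n (c := (c * √n)⁻¹) (by positivity)
  refine ⟨Φ, hΦ, hb, hI.trans_eq ?_⟩
  have hn' : (√(n : ℝ)) ^ 2 = n := Real.sq_sqrt (Nat.cast_nonneg n)
  rw [div_inv_eq_mul]
  field_simp
  rw [hn']
  ring

/-- A uniform deviation inequality for a family of functions that is Lipschitz in a bounded
finite-dimensional parameter. -/
theorem exists_measure_centredSum_le {T : Set E} (hT : Bornology.IsBounded T) {t₀ : E}
    (ht₀ : t₀ ∈ T) {X : ℕ → Ω → 𝒳}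
    (hXm : ∀ i, Measurable (X i)) (hXi : iIndepFun X P) (hXl : ∀ i, P.map (X i) = Q)
    {f : E → 𝒳 → ℝ} (hfm : ∀ t ∈ T, Measurable (f t)) {F : 𝒳 → ℝ} (hF : MemLp F 2 Q)
    (hF0 : ∀ x, 0 ≤ F x) (hLip : ∀ s ∈ T, ∀ t ∈ T, ∀ x, |f s x - f t x| ≤ F x * ‖s - t‖)
    (hf0 : f t₀ = 0) :
    ∃ K : ℝ, ∀ n : ℕ, 0 < n → ∀ r : ℝ, 0 < r →
      P {ω | ∃ t ∈ T, r < |centredSum Q X (f t) n ω|} ≤ ENNReal.ofReal (√n * K / r) := by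
  obtain ⟨R, C, N, hR, hC, hN0, hNT, hcard, hN⟩ := exists_nets hT ht₀
  have hπ : ∀ j b, ∃ b', b ∈ N (j + 1) → b' ∈ N j ∧ ‖b - b'‖ ≤ R / 2 ^ j := fun j b => by
    by_cases hb : b ∈ N (j + 1)
    · obtain ⟨b', h⟩ := hN j b (hNT _ hb)
      exact ⟨b', fun _ => h⟩
    · exact ⟨b, fun h => absurd h hb⟩
  choose π hπ using hπ
  have hFint : Integrable F Q := hF.integrable one_le_two
  have hint : ∀ t ∈ T, Integrable (f t) Q := fun t ht => by
    refine (hFint.mul_const ‖t - t₀‖).mono' (hfm t ht).aestronglyMeasurable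
      (ae_of_all _ fun x => ?_)
    simpa [hf0] using hLip t ht t₀ ht₀ x
  have hsub : ∀ s ∈ T, ∀ t ∈ T, ∀ n ω, centredSum Q X (fun x => f s x - f t x) n ω =
      centredSum Q X (f s) n ω - centredSum Q X (f t) n ω := fun s hs t ht n ω => by
    rw [centredSum, centredSum, centredSum, ← Finset.sum_sub_distrib,
      integral_sub (hint s hs) (hint t ht)]
    exact Finset.sum_congr rfl fun i _ => by ring
  set v := ∫ x, (F x + ∫ y, F y ∂Q) ^ 2 ∂Q with hv
  have hv0 : 0 ≤ v := integral_nonneg fun x => sq_nonneg _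
  have hlogC : 0 ≤ Real.log (2 * C) := Real.log_nonneg (by
    have : (1 : ℝ) ≤ C := by exact_mod_cast hC
    linarith)
  set κ : ℕ → ℝ := fun j => R / 2 ^ j * ((j + 1) * Real.log (2 * C) + 2 * v) with hκ
  have hκ0 : ∀ j, 0 ≤ κ j := fun j => by positivity
  have hκs : Summable κ := by
    have h1 : Summable fun j : ℕ => ((j : ℝ) ^ 1 * (1 / 2 : ℝ) ^ j) :=
      summable_pow_mul_geometric_of_norm_lt_one 1 (by norm_num)
    have h2 : Summable fun j : ℕ => ((1 / 2 : ℝ) ^ j) := summable_geometric_two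
    refine ((h1.mul_left (R * Real.log (2 * C))).add
      (h2.mul_left (R * (Real.log (2 * C) + 2 * v)))).congr fun j => ?_
    simp only [hκ, one_div, inv_pow]
    ring
  refine ⟨∑' j, κ j, fun n hn r hr => ?_⟩
  -- One link of the chain: the increments from level `j + 1` to level `j` form a finite family with
  -- envelope `R / 2 ^ j * F`.
  have hlevel : ∀ j : ℕ, ∃ Φ : Ω → ℝ, Integrable Φ P ∧ (∀ ω, 0 ≤ Φ ω) ∧
      (∀ ω, ∀ b ∈ N (j + 1), |centredSum Q X (f b) n ω - centredSum Q X (f (π j b)) n ω| ≤ Φ ω) ∧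
      ∫ ω, Φ ω ∂P ≤ √n * κ j := fun j => by
    have hne : Nonempty (N (j + 1)) := by
      obtain ⟨b, hb, -⟩ := hN (j + 1) t₀ ht₀
      exact ⟨⟨b, hb⟩⟩
    have hT1 : ∀ b : N (j + 1), (b : E) ∈ T := fun b => hNT _ b.2
    have hT2 : ∀ b : N (j + 1), π j b ∈ T := fun b => hNT _ (hπ j b b.2).1
    obtain ⟨Φ, hΦ, hb, hI⟩ := exists_integrable_bound_centredSum hXm hXi hXl
      (h := fun (b : N (j + 1)) x => f b x - f (π j b) x)
      (fun b => (hfm _ (hT1 b)).sub (hfm _ (hT2 b))) hF (c := R / 2 ^ j) (by positivity)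
      (fun b x => (hLip _ (hT1 b) _ (hT2 b) x).trans (by
        rw [mul_comm]
        exact mul_le_mul_of_nonneg_right (hπ j b b.2).2 (hF0 x))) hn
    refine ⟨Φ, hΦ, fun ω => (abs_nonneg _).trans (hb ω hne.some), fun ω b hbN => ?_, hI.trans ?_⟩
    · rw [← hsub _ (hT1 ⟨b, hbN⟩) _ (hT2 ⟨b, hbN⟩)]
      exact hb ω ⟨b, hbN⟩
    · simp only [hκ]
      gcongr
      rw [Fintype.card_coe]
      have hpos : 0 < (N (j + 1)).card := Finset.card_pos.2 ⟨hne.some, hne.some.2⟩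
      have hle : (2 * ((N (j + 1)).card : ℝ)) ≤ (2 * C) ^ (j + 1) := by
        have h1 : ((N (j + 1)).card : ℝ) ≤ (C : ℝ) ^ (j + 1) := by exact_mod_cast hcard (j + 1)
        rw [mul_pow]
        have h2 : (2 : ℝ) ≤ 2 ^ (j + 1) := by
          rw [pow_succ]
          have := one_le_pow₀ (M₀ := ℝ) one_le_two (n := j)
          linarith
        gcongr
      have := Real.log_le_log (by positivity) hle
      rw [Real.log_pow] at this
      push_cast at this
      exact this
  choose Φ hΦ hΦ0 hb hI using hlevel
  -- Telescoping along the chain of projections, down to `t₀`, where `f` vanishes.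
  have hnet : ∀ ω J, ∀ b ∈ N J, |centredSum Q X (f b) n ω| ≤ ∑ j ∈ Finset.range J, Φ j ω := by
    intro ω J
    induction J with
    | zero =>
      intro b hbN
      rw [hN0, Finset.mem_singleton] at hbN
      simp [hbN, hf0, centredSum]
    | succ J ih =>
      intro b hbN
      rw [Finset.sum_range_succ]
      have h1 := ih _ (hπ J b hbN).1
      have h2 := hb J ω b hbN
      calc |centredSum Q X (f b) n ω| = |centredSum Q X (f (π J b)) n ω +
            (centredSum Q X (f b) n ω - centredSum Q X (f (π J b)) n ω)| := by congr 1; ring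
        _ ≤ _ := (abs_add_le _ _).trans (add_le_add h1 h2)
  -- A crude pathwise Lipschitz bound, used only to pass from net points to all of `T`.
  have hclose : ∀ ω, ∀ s ∈ T, ∀ t ∈ T, |centredSum Q X (f s) n ω - centredSum Q X (f t) n ω| ≤
      (∑ i ∈ Finset.range n, (F (X i ω) + ∫ x, F x ∂Q)) * ‖s - t‖ := fun ω s hs t ht => by
    rw [← hsub s hs t ht, centredSum, Finset.sum_mul]
    refine (Finset.abs_sum_le_sum_abs _ _).trans (Finset.sum_le_sum fun i _ => ?_)
    rw [add_mul]
    refine (abs_sub _ _).trans (add_le_add (hLip s hs t ht _) ?_)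
    rw [← integral_mul_const]
    exact norm_integral_le_of_norm_le (f := fun x => f s x - f t x) (hFint.mul_const _)
      (ae_of_all _ fun x => hLip s hs t ht x)
  -- The uncountable union is placed inside a level set of a countable sum, so no measurability of
  -- the supremum is needed. The strict inequality `r < …` leaves room for the approximation error,
  -- with a level `J` depending on `ω`.
  have hsubset : {ω | ∃ t ∈ T, r < |centredSum Q X (f t) n ω|} ⊆
      {ω | ENNReal.ofReal r ≤ ∑' j, ENNReal.ofReal (Φ j ω)} := by
    rintro ω ⟨t, ht, hrt⟩
    set A := ∑ i ∈ Finset.range n, (F (X i ω) + ∫ x, F x ∂Q) with hA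
    have hA0 : 0 ≤ A := Finset.sum_nonneg fun i _ => add_nonneg (hF0 _) (integral_nonneg hF0)
    have hlim : Tendsto (fun J : ℕ => A * (R / 2 ^ J)) atTop (𝓝 0) := by
      have : Tendsto (fun J : ℕ => (2 : ℝ) ^ J) atTop atTop :=
        tendsto_pow_atTop_atTop_of_one_lt one_lt_two
      simpa using (this.const_div_atTop R).const_mul A
    obtain ⟨J, hJ⟩ := (hlim.eventually (gt_mem_nhds (sub_pos.2 hrt))).exists
    obtain ⟨b, hbN, htb⟩ := hN J t ht
    have h1 := (hclose ω t ht b (hNT J hbN)).trans (mul_le_mul_of_nonneg_left htb hA0)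
    have h2 := hnet ω J b hbN
    have h3 := abs_sub_abs_le_abs_sub (centredSum Q X (f t) n ω) (centredSum Q X (f b) n ω)
    have h4 : r ≤ ∑ j ∈ Finset.range J, Φ j ω := by linarith
    calc ENNReal.ofReal r ≤ ENNReal.ofReal (∑ j ∈ Finset.range J, Φ j ω) :=
          ENNReal.ofReal_le_ofReal h4
      _ = ∑ j ∈ Finset.range J, ENNReal.ofReal (Φ j ω) :=
          ENNReal.ofReal_sum_of_nonneg fun j _ => hΦ0 j ω
      _ ≤ _ := ENNReal.sum_le_tsum _
  have hmeas : ∀ j, AEMeasurable (fun ω => ENNReal.ofReal (Φ j ω)) P := fun j =>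
    (hΦ j).aemeasurable.ennreal_ofReal
  calc P {ω | ∃ t ∈ T, r < |centredSum Q X (f t) n ω|}
      ≤ P {ω | ENNReal.ofReal r ≤ ∑' j, ENNReal.ofReal (Φ j ω)} := measure_mono hsubset
    _ ≤ (∫⁻ ω, ∑' j, ENNReal.ofReal (Φ j ω) ∂P) / ENNReal.ofReal r :=
        meas_ge_le_lintegral_div (AEMeasurable.tsum hmeas) (by simpa using hr)
          ENNReal.ofReal_ne_top
    _ = (∑' j, ∫⁻ ω, ENNReal.ofReal (Φ j ω) ∂P) / ENNReal.ofReal r := by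
        rw [lintegral_tsum hmeas]
    _ ≤ (∑' j, ENNReal.ofReal (√n * κ j)) / ENNReal.ofReal r := by
        gcongr with j
        rw [← ofReal_integral_eq_lintegral_ofReal (hΦ j) (ae_of_all _ (hΦ0 j))]
        exact ENNReal.ofReal_le_ofReal (hI j)
    _ = ENNReal.ofReal (√n * (∑' j, κ j) / r) := by
        rw [← ENNReal.ofReal_tsum_of_nonneg (fun j => mul_nonneg (Real.sqrt_nonneg _) (hκ0 j))
          (hκs.mul_left _), tsum_mul_left, ENNReal.ofReal_div_of_pos hr]

end Chaining

/-! ### Measures with a given marginal, concentrated on a given set -/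

/-- Attach to `τ` the conditional kernel of `μ` restricted to the sections of `A` and renormalised;
each section has positive mass, so the first marginal is preserved. -/
theorem exists_measure_fst_eq_of_condKernel_pos {α β : Type*} [MeasurableSpace α]
    [MeasurableSpace β] [StandardBorelSpace β] [Nonempty β] {μ : Measure (α × β)}
    [IsFiniteMeasure μ] {τ : Measure α} [IsProbabilityMeasure τ] (hτ : τ ≪ μ.fst)
    {A : Set (α × β)} (hA : MeasurableSet A)
    (hpos : ∀ᵐ a ∂μ.fst, 0 < μ.condKernel a (Prod.mk a ⁻¹' A)) :
    ∃ ρ : Measure (α × β), IsProbabilityMeasure ρ ∧ ρ ≪ μ ∧ ρ.fst = τ ∧ ∀ᵐ z ∂ρ, z ∈ A := by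
  set κ := μ.condKernel with hκ
  set h : α → ℝ≥0∞ := fun a => κ a (Prod.mk a ⁻¹' A) with hh
  have hhm : Measurable h := Kernel.measurable_kernel_prodMk_left hA
  set g : α × β → ℝ≥0∞ := A.indicator fun z => (h z.1)⁻¹ with hg
  have hgm : Measurable g := (hhm.comp measurable_fst).inv.indicator hA
  have hfst : ((τ ⊗ₘ κ).withDensity g).fst = τ := by
    ext B hB
    rw [Measure.fst_apply hB, withDensity_apply _ (measurable_fst hB),
      ← Set.prod_univ, Measure.setLIntegral_compProd hgm hB MeasurableSet.univ]
    have : ∀ᵐ a ∂τ, ∫⁻ b in Set.univ, g (a, b) ∂κ a = 1 := by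
      filter_upwards [hτ.ae_le hpos] with a ha
      have hga : (fun b => g (a, b)) = (Prod.mk a ⁻¹' A).indicator fun _ => (h a)⁻¹ := by
        ext b; by_cases hb : (a, b) ∈ A <;> simp [hg, hb]
      rw [Measure.restrict_univ, hga, lintegral_indicator_const (measurable_prodMk_left hA)]
      exact ENNReal.inv_mul_cancel ha.ne' (measure_ne_top _ _)
    rw [lintegral_congr_ae (ae_restrict_of_ae this)]
    simp
  refine ⟨(τ ⊗ₘ κ).withDensity g, ⟨?_⟩, ?_, hfst, ?_⟩
  · rw [← Measure.fst_univ, hfst, measure_univ]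
  · refine (withDensity_absolutelyContinuous _ _).trans ?_
    conv_rhs => rw [← μ.disintegrate μ.condKernel]
    exact hτ.compProd_left _
  · rw [ae_withDensity_iff hgm]
    refine ae_of_all _ fun z hz => ?_
    by_contra hzA
    exact hz (Set.indicator_of_notMem hzA _)

namespace MissingGMM

variable {d dθ dφ : ℕ} {M : MissingGMM d dθ dφ}

/-- The maximum `max_{z₂ ∈ 𝒵₂} u'φ(z₁, z₂, θ)`. -/
noncomputable def envelope (M : MissingGMM d dθ dφ) (θ : Euc dθ) (u : Euc dφ) (z₁ : Euc d) : ℝ :=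
  sSup ((fun z₂ => ⟪u, M.φ z₁ z₂ θ⟫) '' M.Z2)

/-! ### Support, continuity and boundedness -/

theorem MomentAndSupport.ae_mem (hM : M.MomentAndSupport) {ρ : Measure (Euc d × Euc d)}
    (hρ : ρ ≪ M.μ) : ∀ᵐ z ∂ρ, z ∈ M.Z1 ×ˢ M.Z2 :=
  hρ hM.μ_support

theorem MomentAndSupport.nonempty (hM : M.MomentAndSupport) : (M.Z1 ×ˢ M.Z2).Nonempty := by
  rw [Set.nonempty_iff_ne_empty]
  intro h
  have := hM.μ_support
  rw [h, Set.compl_empty, measure_univ] at this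
  exact one_ne_zero this

theorem MomentAndSupport.isCompact (hM : M.MomentAndSupport) : IsCompact (M.Z1 ×ˢ M.Z2) :=
  hM.Z1_compact.prod hM.Z2_compact

theorem MomentAndSupport.continuousOn_inner (hM : M.MomentAndSupport) {θ : Euc dθ}
    (hθ : θ ∈ M.Θ) (u : Euc dφ) :
    ContinuousOn (fun z : Euc d × Euc d => ⟪u, M.φ z.1 z.2 θ⟫) (M.Z1 ×ˢ M.Z2) :=
  continuousOn_const.inner (hM.φ_continuous θ hθ)

theorem MomentAndSupport.continuousOn_inner_right (hM : M.MomentAndSupport) {θ : Euc dθ}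
    (hθ : θ ∈ M.Θ) (u : Euc dφ) {z₁ : Euc d} (hz₁ : z₁ ∈ M.Z1) :
    ContinuousOn (fun z₂ : Euc d => ⟪u, M.φ z₁ z₂ θ⟫) M.Z2 :=
  (hM.continuousOn_inner hθ u).comp (f := fun z₂ => (z₁, z₂)) (by fun_prop)
    fun _ hz₂ => ⟨hz₁, hz₂⟩

theorem MomentAndSupport.le_envelope (hM : M.MomentAndSupport) {θ : Euc dθ} (hθ : θ ∈ M.Θ)
    (u : Euc dφ) {z₁ z₂ : Euc d} (hz₁ : z₁ ∈ M.Z1) (hz₂ : z₂ ∈ M.Z2) :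
    ⟪u, M.φ z₁ z₂ θ⟫ ≤ M.envelope θ u z₁ :=
  le_csSup (hM.Z2_compact.bddAbove_image (hM.continuousOn_inner_right hθ u hz₁))
    (Set.mem_image_of_mem _ hz₂)

theorem MomentAndSupport.envelope_le (hM : M.MomentAndSupport) {θ : Euc dθ}
    {u : Euc dφ} {z₁ : Euc d} {b : ℝ} (h : ∀ z₂ ∈ M.Z2, ⟪u, M.φ z₁ z₂ θ⟫ ≤ b) :
    M.envelope θ u z₁ ≤ b :=
  csSup_le (hM.nonempty.snd.image _) (Set.forall_mem_image.2 h)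

theorem MomentAndSupport.continuousOn_envelope (hM : M.MomentAndSupport) {θ : Euc dθ}
    (hθ : θ ∈ M.Θ) (u : Euc dφ) : ContinuousOn (M.envelope θ u) M.Z1 := by
  rw [continuousOn_iff_continuous_domRestrict]
  have : CompactSpace M.Z2 := isCompact_iff_compactSpace.1 hM.Z2_compact
  have hc : Continuous fun q : M.Z1 × M.Z2 => ⟪u, M.φ q.1 q.2 θ⟫ :=
    (hM.continuousOn_inner hθ u).comp_continuous (f := fun q : M.Z1 × M.Z2 => (q.1.1, q.2.1))
      (by fun_prop) fun q => ⟨q.1.2, q.2.2⟩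
  have := (isCompact_univ (X := M.Z2)).continuous_sSup
    (f := fun (z₁ : M.Z1) (z₂ : M.Z2) => ⟪u, M.φ z₁ z₂ θ⟫) hc
  refine this.congr fun z₁ => ?_
  rw [Set.domRestrict_apply, envelope]
  congr 1
  ext y
  simp

/-- Nothing is known about `φ` off `𝒵₁ × 𝒵₂`, so global measurability requires a cutoff. `A` is left
general so that the null set where the Lipschitz bound fails can be removed too. -/
theorem MomentAndSupport.measurable_indicator_inner (hM : M.MomentAndSupport) {θ : Euc dθ}
    (hθ : θ ∈ M.Θ) (u : Euc dφ) {A : Set (Euc d)} (hA : MeasurableSet A) (hAZ : A ⊆ M.Z1) :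
    Measurable ((A ×ˢ M.Z2).indicator fun z : Euc d × Euc d => ⟪u, M.φ z.1 z.2 θ⟫) := by
  classical
  rw [← Set.piecewise_eq_indicator]
  exact ((hM.continuousOn_inner hθ u).mono (Set.prod_mono_left hAZ)).measurable_piecewise
    continuousOn_const (hA.prod hM.Z2_compact.measurableSet)

theorem MomentAndSupport.measurable_indicator_envelope (hM : M.MomentAndSupport) {θ : Euc dθ}
    (hθ : θ ∈ M.Θ) (u : Euc dφ) {A : Set (Euc d)} (hA : MeasurableSet A) (hAZ : A ⊆ M.Z1) :
    Measurable (A.indicator (M.envelope θ u)) := by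
  classical
  rw [← Set.piecewise_eq_indicator]
  exact ((hM.continuousOn_envelope hθ u).mono hAZ).measurable_piecewise continuousOn_const hA

theorem MomentAndSupport.integrable_moment (hM : M.MomentAndSupport) {θ : Euc dθ}
    (hθ : θ ∈ M.Θ) {ρ : Measure (Euc d × Euc d)} [IsFiniteMeasure ρ] (hρ : ρ ≪ M.μ) :
    Integrable (fun z : Euc d × Euc d => M.φ z.1 z.2 θ) ρ := by
  have := (hM.φ_continuous θ hθ).integrableOn_compact (μ := ρ) hM.isCompact
  rwa [IntegrableOn, Measure.restrict_eq_self_of_ae_mem (hM.ae_mem hρ)] at this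

theorem MomentAndSupport.integrable_envelope (hM : M.MomentAndSupport) {θ : Euc dθ}
    (hθ : θ ∈ M.Θ) (u : Euc dφ) {ρ : Measure (Euc d × Euc d)} [IsFiniteMeasure ρ]
    (hρ : ρ ≪ M.μ) : Integrable (M.envelope θ u) ρ.fst := by
  have := (hM.continuousOn_envelope hθ u).integrableOn_compact (μ := ρ.fst) hM.Z1_compact
  rwa [IntegrableOn, Measure.restrict_eq_self_of_ae_mem] at this
  exact (ae_map_iff measurable_fst.aemeasurable hM.Z1_compact.measurableSet).2
    ((hM.ae_mem hρ).mono fun z hz => hz.1)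

theorem integral_fst {ρ : Measure (Euc d × Euc d)} {f : Euc d → ℝ} (hf : Integrable f ρ.fst) :
    ∫ z, f z.1 ∂ρ = ∫ z₁, f z₁ ∂ρ.fst :=
  (integral_map measurable_fst.aemeasurable hf.aestronglyMeasurable).symm

theorem integrable_comp_fst {ρ : Measure (Euc d × Euc d)} {f : Euc d → ℝ}
    (hf : Integrable f ρ.fst) : Integrable (fun z : Euc d × Euc d => f z.1) ρ :=
  hf.comp_measurable measurable_fst

theorem MomentAndSupport.inner_moment (hM : M.MomentAndSupport) {θ : Euc dθ}
    (hθ : θ ∈ M.Θ) (u : Euc dφ) {ρ : Measure (Euc d × Euc d)} [IsFiniteMeasure ρ]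
    (hρ : ρ ≪ M.μ) : ⟪u, M.moment ρ θ⟫ = ∫ z, ⟪u, M.φ z.1 z.2 θ⟫ ∂ρ :=
  (integral_inner (hM.integrable_moment hθ hρ) u).symm

/-! ### The conditional distributions -/

theorem measurableSet_fst_eq (s : Bool) :
    MeasurableSet {x : Bool × Euc d × Euc d | x.1 = s} :=
  measurable_fst (MeasurableSet.singleton s)

theorem distGiven_absolutelyContinuous (s : Bool) : M.distGiven s ≪ M.jointDist :=
  (cond_absolutelyContinuous).map measurable_snd

theorem law_real_false : M.law.real {x | x.1 = false} = 1 - M.selProb := by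
  rw [selProb, ← probReal_compl_eq_one_sub (measurableSet_fst_eq true)]
  congr 1
  ext x
  simp

theorem isProbabilityMeasure_distGiven {s : Bool} (h : 0 < M.law.real {x | x.1 = s}) :
    IsProbabilityMeasure (M.distGiven s) := by
  have : IsProbabilityMeasure (ProbabilityTheory.cond M.law {x | x.1 = s}) :=
    cond_isProbabilityMeasure fun h0 => h.ne' (by simp [Measure.real, h0])
  exact Measure.isProbabilityMeasure_map measurable_snd.aemeasurable

theorem setIntegral_law {s : Bool} (h : 0 < M.law.real {x | x.1 = s}) {f : Euc d × Euc d → ℝ}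
    (hf : AEStronglyMeasurable f (M.distGiven s)) :
    ∫ x in {x | x.1 = s}, f x.2 ∂M.law = M.law.real {x | x.1 = s} * ∫ z, f z ∂M.distGiven s := by
  rw [distGiven, integral_map measurable_snd.aemeasurable hf, ProbabilityTheory.cond,
    integral_smul_measure, smul_eq_mul, ENNReal.toReal_inv, ← Measure.real,
    mul_inv_cancel_left₀ h.ne']

/-! ### The population support function -/

/-- The set of observations with `z₁ ∈ A` and, if `s = 1`, `z₂ ∈ 𝒵₂`. -/
def regularObs (M : MissingGMM d dθ dφ) (A : Set (Euc d)) : Set (Bool × Euc d × Euc d) :=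
  {w | w.2.1 ∈ A ∧ (w.1 = true → w.2.2 ∈ M.Z2)}

theorem measurable_observe : Measurable (observe : Bool × Euc d × Euc d → _) :=
  measurable_fst.prodMk ((measurable_fst.comp measurable_snd).prodMk
    (Measurable.ite (measurableSet_fst_eq true) (measurable_snd.comp measurable_snd)
      measurable_const))

instance : IsProbabilityMeasure M.observedLaw :=
  Measure.isProbabilityMeasure_map measurable_observe.aemeasurable

theorem MomentAndSupport.measurable_indicator_score (hM : M.MomentAndSupport) {θ : Euc dθ}
    (hθ : θ ∈ M.Θ) (u : Euc dφ) {A : Set (Euc d)} (hA : MeasurableSet A) (hAZ : A ⊆ M.Z1) :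
    Measurable ((M.regularObs A).indicator (M.score θ u)) := by
  have h : Measurable fun w : Bool × Euc d × Euc d => if w.1 = true then
      (A ×ˢ M.Z2).indicator (fun z : Euc d × Euc d => ⟪u, M.φ z.1 z.2 θ⟫) w.2
      else A.indicator (M.envelope θ u) w.2.1 := Measurable.ite (measurableSet_fst_eq true)
    ((hM.measurable_indicator_inner hθ u hA hAZ).comp measurable_snd)
    ((hM.measurable_indicator_envelope hθ u hA hAZ).comp (measurable_fst.comp measurable_snd))
  convert h using 1
  ext ⟨s, z₁, z₂⟩
  cases s <;> by_cases h1 : z₁ ∈ A <;> by_cases h2 : z₂ ∈ M.Z2 <;>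
    simp [regularObs, score, envelope, h1, h2]

theorem MomentAndSupport.measurableSet_regularObs (hM : M.MomentAndSupport) {A : Set (Euc d)}
    (hA : MeasurableSet A) : MeasurableSet (M.regularObs A) := by
  have h2 : MeasurableSet {w : Bool × Euc d × Euc d | w.2.2 ∈ M.Z2} :=
    (measurable_snd.comp measurable_snd) hM.Z2_compact.measurableSet
  have h1 : MeasurableSet {w : Bool × Euc d × Euc d | w.2.1 ∈ A} :=
    (measurable_fst.comp measurable_snd) hA
  convert h1.inter ((measurableSet_fst_eq true).compl.union h2) using 1
  ext w
  simp [regularObs, imp_iff_not_or]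

theorem MomentAndSupport.ae_mem_regularObs (hM : M.MomentAndSupport) {A : Set (Euc d)}
    (hA : MeasurableSet A) (hAe : ∀ᵐ z₁ ∂M.jointDist.fst, z₁ ∈ A) :
    ∀ᵐ w ∂M.observedLaw, w ∈ M.regularObs A := by
  refine (ae_map_iff (p := (· ∈ M.regularObs A)) measurable_observe.aemeasurable
    (hM.measurableSet_regularObs hA)).2 ?_
  have h1 : ∀ᵐ x ∂M.law, x.2 ∈ M.Z1 ×ˢ M.Z2 :=
    ae_of_ae_map measurable_snd.aemeasurable (hM.ae_mem hM.jointDist_dominated.2)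
  have h2 : ∀ᵐ x ∂M.law, x.2.1 ∈ A :=
    ae_of_ae_map measurable_snd.aemeasurable (ae_of_ae_map measurable_fst.aemeasurable hAe)
  filter_upwards [h1, h2] with x hx1 hx2
  refine ⟨hx2, fun hs => ?_⟩
  change x.1 = true at hs
  simpa [observe, hs] using hx1.2

theorem MomentAndSupport.ae_mem_Z1 (hM : M.MomentAndSupport) {ρ : Measure (Euc d × Euc d)}
    (hρ : ρ ≪ M.μ) : ∀ᵐ z₁ ∂ρ.fst, z₁ ∈ M.Z1 :=
  (ae_map_iff measurable_fst.aemeasurable hM.Z1_compact.measurableSet).2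
    ((hM.ae_mem hρ).mono fun _ hz => hz.1)

theorem MomentAndSupport.integrable_score (hM : M.MomentAndSupport) {θ : Euc dθ}
    (hθ : θ ∈ M.Θ) (u : Euc dφ) : Integrable (M.score θ u) M.observedLaw := by
  have hρ := hM.jointDist_dominated.2
  have := hM.jointDist_dominated.1
  have hm : AEStronglyMeasurable (M.score θ u) M.observedLaw :=
    (hM.measurable_indicator_score hθ u hM.Z1_compact.measurableSet subset_rfl
      ).aestronglyMeasurable.congr ((hM.ae_mem_regularObs hM.Z1_compact.measurableSet
        (hM.ae_mem_Z1 hρ)).mono fun _ hw => Set.indicator_of_mem hw _)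
  rw [observedLaw] at hm ⊢
  rw [integrable_map_measure hm measurable_observe.aemeasurable]
  have h1 := (((hM.integrable_moment hθ hρ).const_inner u).abs.add
    (integrable_comp_fst (hM.integrable_envelope hθ u hρ)).abs).comp_measurable measurable_snd
  refine h1.mono' (hm.comp_measurable measurable_observe) (ae_of_all _ fun x => ?_)
  rcases x with ⟨_ | _, z₁, z₂⟩ <;> simp [observe, score, ← envelope.eq_1]

/-- The population support function in terms of the conditional distributions. -/
theorem MomentAndSupport.integral_score (hM : M.MomentAndSupport)
    (hp : M.selProb ∈ Set.Ioo (0 : ℝ) 1) {θ : Euc dθ} (hθ : θ ∈ M.Θ) (u : Euc dφ) :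
    ∫ w, M.score θ u w ∂M.observedLaw = M.selProb * ⟪u, M.moment (M.distGiven true) θ⟫ +
      (1 - M.selProb) * ∫ z₁, M.envelope θ u z₁ ∂(M.distGiven false).fst := by
  have hpt : 0 < M.law.real {x | x.1 = true} := hp.1
  have hpf : 0 < M.law.real {x | x.1 = false} := by rw [law_real_false]; linarith [hp.2]
  have := isProbabilityMeasure_distGiven hpt
  have := isProbabilityMeasure_distGiven hpf
  have hac : ∀ s, M.distGiven s ≪ M.μ := fun s =>
    (distGiven_absolutelyContinuous s).trans hM.jointDist_dominated.2
  have hint := hM.integrable_score hθ u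
  have henv := hM.integrable_envelope hθ u (hac false)
  rw [observedLaw] at hint ⊢
  rw [integral_map measurable_observe.aemeasurable hint.aestronglyMeasurable,
    ← integral_add_compl (f := fun x => M.score θ u (observe x)) (measurableSet_fst_eq true)
      (hint.comp_measurable measurable_observe)]
  have hc : {x : Bool × Euc d × Euc d | x.1 = true}ᶜ = {x | x.1 = false} := by ext; simp
  rw [hc, hM.inner_moment hθ u (hac true), ← integral_fst henv, ← law_real_false, selProb,
    ← setIntegral_law hpt ((hM.integrable_moment hθ (hac true)).const_inner u).aestronglyMeasurable,
    ← setIntegral_law hpf (integrable_comp_fst henv).aestronglyMeasurable]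
  congr 1
  · refine setIntegral_congr_fun (measurableSet_fst_eq true) fun x hx => ?_
    change x.1 = true at hx
    simp [observe, score, hx]
  · refine setIntegral_congr_fun (measurableSet_fst_eq false) fun x hx => ?_
    change x.1 = false at hx
    simp [observe, score, hx, envelope]

theorem MomentAndSupport.inner_prediction_le (hM : M.MomentAndSupport)
    (hp : M.selProb ∈ Set.Ioo (0 : ℝ) 1) {θ : Euc dθ} (hθ : θ ∈ M.Θ) (u : Euc dφ)
    {ρ : Measure (Euc d × Euc d)} (hρ : ρ ∈ M.missingDists) :
    ⟪u, M.prediction ρ θ⟫ ≤ ∫ w, M.score θ u w ∂M.observedLaw := by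
  obtain ⟨⟨hρp, hρμ⟩, hρf⟩ := hρ
  have henv := hM.integrable_envelope hθ u hρμ
  rw [hM.integral_score hp hθ, prediction, inner_add_right, real_inner_smul_right,
    real_inner_smul_right, hM.inner_moment hθ u hρμ, ← hρf, ← integral_fst henv]
  have h1 : 0 ≤ 1 - M.selProb := by linarith [hp.2]
  gcongr 1
  refine mul_le_mul_of_nonneg_left (integral_mono_ae
    ((hM.integrable_moment hθ hρμ).const_inner u) (integrable_comp_fst henv) ?_) h1
  filter_upwards [hM.ae_mem hρμ] with z hz
  exact hM.le_envelope hθ u hz.1 hz.2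

/-- By continuity the `ε`-maximisers over `𝒵₂` form a nonempty relatively open set, which the
conditional law charges. -/
theorem MomentAndSupport.ae_condKernel_pos (hM : M.MomentAndSupport)
    (hfull : M.ConditionalFullSupport) {θ : Euc dθ} (hθ : θ ∈ M.Θ) (u : Euc dφ) {ε : ℝ}
    (hε : 0 < ε) :
    ∀ᵐ z₁ ∂M.μ.fst, 0 < M.μ.condKernel z₁ (Prod.mk z₁ ⁻¹'
      {z | z ∈ M.Z1 ×ˢ M.Z2 ∧ M.envelope θ u z.1 - ε < ⟪u, M.φ z.1 z.2 θ⟫}) := by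
  have hsupp : ∀ᵐ z₁ ∂M.μ.fst, ∀ᵐ z₂ ∂M.μ.condKernel z₁, (z₁, z₂) ∈ M.Z1 ×ˢ M.Z2 := by
    apply Measure.ae_ae_of_ae_compProd
    rw [M.μ.disintegrate M.μ.condKernel]
    exact hM.ae_mem Measure.AbsolutelyContinuous.rfl
  filter_upwards [hfull, hsupp, hM.ae_mem_Z1 Measure.AbsolutelyContinuous.rfl] with z₁ h1 h2 hz₁
  obtain ⟨-, ⟨z₂, hz₂, rfl⟩, hlt⟩ := exists_lt_of_lt_csSup
    (hM.nonempty.snd.image fun z₂ => ⟪u, M.φ z₁ z₂ θ⟫)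
    (show M.envelope θ u z₁ - ε < _ from sub_lt_self _ hε)
  obtain ⟨U, hU, hUeq⟩ := continuousOn_iff'.1 (hM.continuousOn_inner_right hθ u hz₁)
    (Set.Ioi (M.envelope θ u z₁ - ε)) isOpen_Ioi
  have hmem : z₂ ∈ U ∩ M.Z2 := hUeq ▸ ⟨hlt, hz₂⟩
  refine (h1 U hU ⟨z₂, hmem⟩).trans_le (measure_mono_ae ?_)
  filter_upwards [h2] with y hy hyU
  have : y ∈ (fun z₂ => ⟪u, M.φ z₁ z₂ θ⟫) ⁻¹' Set.Ioi (M.envelope θ u z₁ - ε) ∩ M.Z2 :=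
    hUeq ▸ ⟨hyU, hy.2⟩
  exact ⟨hy, this.1⟩

theorem MomentAndSupport.exists_le_inner_prediction (hM : M.MomentAndSupport)
    (hp : M.selProb ∈ Set.Ioo (0 : ℝ) 1) (hfull : M.ConditionalFullSupport) {θ : Euc dθ}
    (hθ : θ ∈ M.Θ) (u : Euc dφ) {ε : ℝ} (hε : 0 < ε) :
    ∃ ρ ∈ M.missingDists, ∫ w, M.score θ u w ∂M.observedLaw - ε ≤ ⟪u, M.prediction ρ θ⟫ := by
  have hpf : 0 < M.law.real {x | x.1 = false} := by rw [law_real_false]; linarith [hp.2]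
  have := isProbabilityMeasure_distGiven hpf
  have hac : (M.distGiven false).fst ≪ M.μ.fst :=
    ((distGiven_absolutelyContinuous false).trans hM.jointDist_dominated.2).map measurable_fst
  have hA : MeasurableSet
      {z | z ∈ M.Z1 ×ˢ M.Z2 ∧ M.envelope θ u z.1 - ε < ⟪u, M.φ z.1 z.2 θ⟫} := by
    have hZ1 := hM.Z1_compact.measurableSet
    have h := (hM.isCompact.measurableSet).inter (measurableSet_lt
      (((hM.measurable_indicator_envelope hθ u hZ1 subset_rfl).comp measurable_fst).sub_const ε)
      (hM.measurable_indicator_inner hθ u hZ1 subset_rfl))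
    convert h using 1
    ext z
    simp only [Set.mem_ofPred_eq, Set.mem_inter_iff, Function.comp_apply]
    refine and_congr_right fun hz => ?_
    rw [Set.indicator_of_mem hz, Set.indicator_of_mem hz.1]
  obtain ⟨ρ, hρp, hρμ, hρf, hρA⟩ := exists_measure_fst_eq_of_condKernel_pos hac hA
    (hM.ae_condKernel_pos hfull hθ u hε)
  refine ⟨ρ, ⟨⟨hρp, hρμ⟩, hρf⟩, ?_⟩
  have henv := hM.integrable_envelope hθ u hρμ
  rw [hM.integral_score hp hθ, prediction, inner_add_right, real_inner_smul_right,
    real_inner_smul_right, hM.inner_moment hθ u hρμ, ← hρf, ← integral_fst henv]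
  have h1 : ∫ z, M.envelope θ u z.1 ∂ρ - ε ≤ ∫ z, ⟪u, M.φ z.1 z.2 θ⟫ ∂ρ := by
    have h2 : ∫ z, (M.envelope θ u z.1 - ε) ∂ρ = ∫ z, M.envelope θ u z.1 ∂ρ - ε := by
      rw [integral_sub (integrable_comp_fst henv) (integrable_const _)]
      simp
    rw [← h2]
    refine integral_mono_ae ((integrable_comp_fst henv).sub (integrable_const _))
      ((hM.integrable_moment hθ hρμ).const_inner u) ?_
    filter_upwards [hρA] with z hz using hz.2.le
  -- The actual loss is `(1 - p) * ε`, at most `ε`.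
  nlinarith [hp.1, hp.2]

/-- The population support function is dominated by the support function of `N(θ)`. -/
theorem MomentAndSupport.integral_score_le_supportFn (hM : M.MomentAndSupport)
    (hp : M.selProb ∈ Set.Ioo (0 : ℝ) 1) (hfull : M.ConditionalFullSupport) {θ : Euc dθ}
    (hθ : θ ∈ M.Θ) (u : Euc dφ) :
    ∫ w, M.score θ u w ∂M.observedLaw ≤ M.supportFn θ u := by
  refine le_of_forall_pos_sub_le fun ε hε => ?_
  obtain ⟨ρ, hρ, hle⟩ := hM.exists_le_inner_prediction hp hfull hθ u hε
  refine hle.trans (le_csSup ⟨∫ w, M.score θ u w ∂M.observedLaw, ?_⟩ ⟨_, ⟨ρ, hρ, rfl⟩, rfl⟩)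
  rintro _ ⟨_, ⟨ρ', hρ', rfl⟩, rfl⟩
  exact hM.inner_prediction_le hp hθ u hρ'

end MissingGMM

namespace MissingGMM

variable {d dθ dφ : ℕ} {M : MissingGMM d dθ dφ}

/-! ### From uniform deviations to the Hausdorff distance -/

theorem MomentAndSupport.hausdorffEDist_estimator_le (hM : M.MomentAndSupport)
    (hp : M.selProb ∈ Set.Ioo (0 : ℝ) 1) (hfull : M.ConditionalFullSupport)
    (hne : M.identifiedSet.Nonempty) {m : ℝ≥0 → ℝ≥0} (hm : Monotone m)
    (hcrit : ∀ θ ∈ M.Θ, M.criterion θ ≤ -(m (Metric.infNndist θ M.identifiedSet) : ℝ))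
    {n : ℕ} {w : ℕ → Bool × Euc d × Euc d} {η : ℝ}
    (hdev : ∀ θ ∈ M.Θ, ∀ u ∈ Metric.closedBall (0 : Euc dφ) 1,
      |M.sampleSupportFn n w θ u - ∫ x, M.score θ u x ∂M.observedLaw| ≤ η)
    (hbdd : ∀ θ ∈ M.Θ, BddBelow (M.sampleSupportFn n w θ '' Metric.closedBall 0 1))
    {δ : ℝ≥0} (hδ : 2 * η < m δ) :
    Metric.hausdorffEDist M.identifiedSet (M.estimator n w η) ≤ δ := by
  have hball : (Metric.closedBall (0 : Euc dφ) 1).Nonempty := ⟨0, by simp⟩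
  refine Metric.hausdorffEDist_le_of_infEDist (fun θ hθ => ?_) (fun θ hθ => ?_)
  · obtain ⟨hθΘ, ρ, hρ, hρ0⟩ := hθ
    have : θ ∈ M.estimator n w η := by
      refine ⟨hθΘ, le_csInf (hball.image _) (Set.forall_mem_image.2 fun u hu => ?_)⟩
      have h1 := hM.inner_prediction_le hp hθΘ u hρ
      rw [hρ0, inner_zero_right] at h1
      linarith [(abs_le.1 (hdev θ hθΘ u hu)).1]
    rw [Metric.infEDist_zero_of_mem this]
    exact zero_le
  · obtain ⟨hθΘ, hθη⟩ := hθ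
    have h1 : -(2 * η) ≤ M.criterion θ := by
      refine le_csInf (hball.image _) (Set.forall_mem_image.2 fun u hu => ?_)
      have h2 := hM.integral_score_le_supportFn hp hfull hθΘ u
      have h3 : M.sampleCriterion n w θ ≤ M.sampleSupportFn n w θ u :=
        csInf_le (hbdd θ hθΘ) (Set.mem_image_of_mem _ hu)
      linarith [(abs_le.1 (hdev θ hθΘ u hu)).2]
    have h2 : Metric.infNndist θ M.identifiedSet < δ := by
      -- From `m (dist) ≤ 2η < m δ`, monotonicity alone gives `dist < δ`.
      refine hm.reflect_lt ?_
      have := hcrit θ hθΘ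
      exact_mod_cast (show (m (Metric.infNndist θ M.identifiedSet) : ℝ) < m δ by linarith)
    rw [← ENNReal.coe_toNNReal (Metric.infEDist_ne_top hne)]
    exact_mod_cast h2.le

/-! ### Lipschitz continuity of the score -/

theorem score_zero (θ : Euc dθ) : M.score θ 0 = 0 := by
  ext w
  rcases M.Z2.eq_empty_or_nonempty with h | h <;> simp [score, h]

theorem MomentAndSupport.abs_score_sub_le (hM : M.MomentAndSupport) {w : Bool × Euc d × Euc d}
    {A : Set (Euc d)} (hAZ : A ⊆ M.Z1) (hw : w ∈ M.regularObs A) {θ θ' : Euc dθ} (hθ : θ ∈ M.Θ)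
    (hθ' : θ' ∈ M.Θ) {u u' : Euc dφ} {b : ℝ}
    (h : ∀ z₂ ∈ M.Z2, |⟪u, M.φ w.2.1 z₂ θ⟫ - ⟪u', M.φ w.2.1 z₂ θ'⟫| ≤ b) :
    |M.score θ u w - M.score θ' u' w| ≤ b := by
  have hz₁ := hAZ hw.1
  obtain ⟨s, z₁, z₂⟩ := w
  cases s with
  | true => simpa [score] using h z₂ (hw.2 rfl)
  | false =>
    change |M.envelope θ u z₁ - M.envelope θ' u' z₁| ≤ b
    rw [abs_sub_le_iff, sub_le_iff_le_add, sub_le_iff_le_add]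
    constructor
    · refine hM.envelope_le fun y hy => ?_
      linarith [(abs_le.1 (h y hy)).2, hM.le_envelope hθ' u' hz₁ hy]
    · refine hM.envelope_le fun y hy => ?_
      linarith [(abs_le.1 (h y hy)).1, hM.le_envelope hθ u hz₁ hy]

theorem abs_inner_sub_inner_le {E : Type*} [NormedAddCommGroup E] [InnerProductSpace ℝ E]
    (u u' v v' : E) : |⟪u, v⟫ - ⟪u', v'⟫| ≤ ‖u‖ * ‖v - v'‖ + ‖u - u'‖ * ‖v'‖ := by
  have : ⟪u, v⟫ - ⟪u', v'⟫ = ⟪u, v - v'⟫ + ⟪u - u', v'⟫ := by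
    rw [inner_sub_right, inner_sub_left]; ring
  rw [this]
  exact (abs_add_le _ _).trans (add_le_add (abs_real_inner_le_norm _ _)
    (abs_real_inner_le_norm _ _))

/-- On a set of observations of full measure, the score is Lipschitz in `(θ, u)`, with a square
integrable constant. -/
theorem MomentAndSupport.exists_lipschitz_score (hM : M.MomentAndSupport)
    (hLip : M.LipschitzMoments) {θ₀ : Euc dθ} (hθ₀ : θ₀ ∈ M.Θ) :
    ∃ (A : Set (Euc d)) (F : Bool × Euc d × Euc d → ℝ), MeasurableSet A ∧ A ⊆ M.Z1 ∧
      (∀ᵐ w ∂M.observedLaw, w ∈ M.regularObs A) ∧ MemLp F 2 M.observedLaw ∧ (∀ w, 0 ≤ F w) ∧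
      ∀ w ∈ M.regularObs A, ∀ s ∈ M.Θ ×ˢ Metric.closedBall (0 : Euc dφ) 1,
        ∀ t ∈ M.Θ ×ˢ Metric.closedBall (0 : Euc dφ) 1,
          |M.score s.1 s.2 w - M.score t.1 t.2 w| ≤ F w * ‖s - t‖ := by
  obtain ⟨L, hL, hLae⟩ := hLip
  obtain ⟨A, hAe, hA, hAp⟩ :=
    (hLae.and (hM.ae_mem_Z1 hM.jointDist_dominated.2)).exists_measurable_mem
  obtain ⟨D, hD⟩ := Metric.isBounded_iff.1 hM.Θ_compact.isBounded
  have hD0 : 0 ≤ D := dist_nonneg.trans (hD hθ₀ hθ₀)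
  obtain ⟨B, hB⟩ := hM.isCompact.exists_bound_of_continuousOn (hM.φ_continuous θ₀ hθ₀)
  have hB0 : 0 ≤ B := (norm_nonneg _).trans (hB _ hM.nonempty.some_mem)
  have hobs := hM.ae_mem_regularObs hA hAe
  -- Moving `θ` costs `|L|` since `‖u‖ ≤ 1`; moving `u` costs `‖φ‖ ≤ |L| * D + B`, by comparison
  -- with `θ₀`.
  refine ⟨A, fun w => |L w.2.1| * (1 + D) + B, hA, fun z hz => (hAp z hz).2, hobs, ?_,
    fun w => by positivity, ?_⟩
  · have hmp : MeasurePreserving (fun w : Bool × Euc d × Euc d => w.2.1) M.observedLaw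
        M.jointDist.fst := by
      refine ⟨measurable_fst.comp measurable_snd, ?_⟩
      rw [jointDist, Measure.fst, Measure.map_map measurable_fst measurable_snd]
      exact Measure.map_map (measurable_fst.comp measurable_snd) measurable_observe
    have h := (hL.comp_measurePreserving hmp).norm.const_mul (1 + D)
    refine (h.add (memLp_const B)).ae_eq (ae_of_all _ fun w => ?_)
    simp [mul_comm]
  · rintro w hw ⟨θ, u⟩ ⟨hθ, hu⟩ ⟨θ', u'⟩ ⟨hθ', hu'⟩
    refine hM.abs_score_sub_le (fun z hz => (hAp z hz).2) hw hθ hθ' fun z₂ hz₂ => ?_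
    obtain ⟨hLw, hz₁⟩ := hAp _ hw.1
    have hle : ∀ a ∈ M.Θ, ∀ b ∈ M.Θ, ‖M.φ w.2.1 z₂ a - M.φ w.2.1 z₂ b‖ ≤ |L w.2.1| * ‖a - b‖ :=
      fun a ha b hb => (hLw z₂ hz₂ a ha b hb).trans
        (mul_le_mul_of_nonneg_right (le_abs_self _) (norm_nonneg _))
    have h1 : ‖M.φ w.2.1 z₂ θ'‖ ≤ |L w.2.1| * D + B := by
      calc ‖M.φ w.2.1 z₂ θ'‖ = ‖(M.φ w.2.1 z₂ θ' - M.φ w.2.1 z₂ θ₀) + M.φ w.2.1 z₂ θ₀‖ := by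
            rw [sub_add_cancel]
        _ ≤ |L w.2.1| * D + B := by
            refine (norm_add_le _ _).trans (add_le_add ((hle _ hθ' _ hθ₀).trans ?_)
              (hB (w.2.1, z₂) ⟨hz₁, hz₂⟩))
            rw [← dist_eq_norm]
            exact mul_le_mul_of_nonneg_left (hD hθ' hθ₀) (abs_nonneg _)
    have hn1 : ‖θ - θ'‖ ≤ ‖(θ, u) - (θ', u')‖ := norm_fst_le ((θ, u) - (θ', u'))
    have hn2 : ‖u - u'‖ ≤ ‖(θ, u) - (θ', u')‖ := norm_snd_le ((θ, u) - (θ', u'))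
    have hu1 : ‖u‖ ≤ 1 := by simpa using hu
    calc _ ≤ ‖u‖ * ‖M.φ w.2.1 z₂ θ - M.φ w.2.1 z₂ θ'‖ + ‖u - u'‖ * ‖M.φ w.2.1 z₂ θ'‖ :=
          abs_inner_sub_inner_le _ _ _ _
      _ ≤ 1 * (|L w.2.1| * ‖(θ, u) - (θ', u')‖) + ‖(θ, u) - (θ', u')‖ * (|L w.2.1| * D + B) := by
          gcongr
          exact (hle _ hθ _ hθ').trans (by gcongr)
      _ = _ := by ring

end MissingGMM

/-! ### Hausdorff consistency of the set estimator -/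

theorem mainTheorem6 {d dθ dφ : ℕ} (M : MissingGMM d dθ dφ)
    (hp : M.selProb ∈ Set.Ioo (0 : ℝ) 1)
    (hM : M.MomentAndSupport)
    (hfull : M.ConditionalFullSupport)
    (hLip : M.LipschitzMoments)
    (hne : M.identifiedSet.Nonempty)
    (hsep : M.Separation)
    (η : ℕ → ℝ) (hη_pos : ∀ n, 0 < η n) (hη_lim : Tendsto η atTop (𝓝 0))
    (hη_rate : (fun n : ℕ => (n : ℝ) ^ (-(1 / 2) : ℝ)) =o[atTop] η)
    {Ω : Type*} [MeasurableSpace Ω] (P : Measure Ω) [IsProbabilityMeasure P]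
    (W : ℕ → Ω → Bool × Euc d × Euc d)
    (hW_meas : ∀ i, Measurable (W i))
    (hW_indep : iIndepFun W P)
    (hW_law : ∀ i, P.map (W i) = M.observedLaw) :
    ∀ ε : ℝ≥0∞, 0 < ε →
      Tendsto
        (fun n : ℕ => P {ω | ε ≤ Metric.hausdorffEDist M.identifiedSet
          (M.estimator n (fun i => W i ω) (η n))})
        atTop (𝓝 0) := by
  intro ε hε
  obtain ⟨δ, hδ, hδε⟩ := ENNReal.lt_iff_exists_nnreal_btwn.1 hε
  have hδ0 : 0 < δ := by exact_mod_cast hδ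
  obtain ⟨m, hm, -, hmpos, hcrit⟩ := hsep
  obtain ⟨θ₀, hθ₀, -⟩ := id hne
  obtain ⟨A, F, hA, hAZ, hobs, hF, hF0, hlip⟩ := hM.exists_lipschitz_score hLip hθ₀
  set T : Set (Euc dθ × Euc dφ) := M.Θ ×ˢ Metric.closedBall 0 1 with hT
  -- Cutting the score off outside `regularObs A` makes measurability and the Lipschitz bound hold
  -- everywhere, and changes nothing almost surely.
  set f : Euc dθ × Euc dφ → Bool × Euc d × Euc d → ℝ := fun t =>
    (M.regularObs A).indicator (M.score t.1 t.2) with hf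
  have hfscore : ∀ t, ∫ x, f t x ∂M.observedLaw = ∫ x, M.score t.1 t.2 x ∂M.observedLaw := fun t =>
    integral_congr_ae (hobs.mono fun _ hw => Set.indicator_of_mem hw _)
  obtain ⟨K, hK⟩ := exists_measure_centredSum_le
    (hM.Θ_compact.isBounded.prod Metric.isBounded_closedBall)
    (show (θ₀, (0 : Euc dφ)) ∈ T from ⟨hθ₀, by simp⟩) hW_meas hW_indep hW_law (f := f)
    (fun t ht => hM.measurable_indicator_score ht.1 _ hA hAZ) hF hF0
    (fun s hs t ht x => by
      by_cases hx : x ∈ M.regularObs A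
      · simpa [hf, hx] using hlip x hx s hs t ht
      · simpa [hf, hx] using mul_nonneg (hF0 x) (norm_nonneg _))
    (by simp [hf, MissingGMM.score_zero])
  have hWobs : ∀ᵐ ω ∂P, ∀ i, W i ω ∈ M.regularObs A := ae_all_iff.2 fun i =>
    ae_of_ae_map (hW_meas i).aemeasurable (by rwa [hW_law i])
  have hbound : ∀ᶠ n : ℕ in atTop, P {ω | ε ≤ Metric.hausdorffEDist M.identifiedSet
      (M.estimator n (fun i => W i ω) (η n))} ≤
      ENNReal.ofReal (K * ((n : ℝ) ^ (-(1 / 2) : ℝ) / η n)) := by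
    have h2η : ∀ᶠ n in atTop, 2 * η n < m δ := by
      have : Tendsto (fun n => 2 * η n) atTop (𝓝 0) := by simpa using hη_lim.const_mul 2
      exact this.eventually (gt_mem_nhds (by exact_mod_cast hmpos δ hδ0))
    filter_upwards [h2η, eventually_gt_atTop 0] with n hn2 hn
    have hn' : (0 : ℝ) < n := by exact_mod_cast hn
    have heq : √(n : ℝ) * K / (n * η n) = K * ((n : ℝ) ^ (-(1 / 2) : ℝ) / η n) := by
      have hs : √(n : ℝ) ≠ 0 := (Real.sqrt_pos.2 hn').ne'
      have := (hη_pos n).ne'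
      rw [Real.rpow_neg hn'.le, ← Real.sqrt_eq_rpow]
      field_simp
      rw [Real.sq_sqrt hn'.le, mul_comm]
    rw [← heq]
    -- Level `r = n * η n` for the unnormalised sums gives the bound `K n^{-1/2} / η n`, which
    -- vanishes by the rate condition.
    refine (measure_mono_ae ?_).trans (hK n hn (n * η n) (mul_pos hn' (hη_pos n)))
    filter_upwards [hWobs] with ω hω hbad
    by_contra hgood
    have hdev : ∀ t ∈ T, |centredSum M.observedLaw W (f t) n ω| ≤ n * η n := fun t ht => by
      by_contra hlt
      exact hgood ⟨t, ht, not_le.1 hlt⟩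
    have hsum : ∀ θ u, M.sampleSupportFn n (fun i => W i ω) θ u =
        1 / n * ∑ i ∈ Finset.range n, f (θ, u) (W i ω) := fun θ u => by
      rw [MissingGMM.sampleSupportFn]
      congr 1
      exact Finset.sum_congr rfl fun i _ => (Set.indicator_of_mem (hω i) _).symm
    refine absurd hbad (not_le.2 ((hM.hausdorffEDist_estimator_le hp hfull hne hm hcrit
      (fun θ hθ u hu => ?_) (fun θ hθ => ?_) hn2).trans_lt hδε))
    · have h1 := hdev (θ, u) ⟨hθ, hu⟩
      have h2 : M.sampleSupportFn n (fun i => W i ω) θ u - ∫ x, M.score θ u x ∂M.observedLaw =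
          centredSum M.observedLaw W (f (θ, u)) n ω / n := by
        rw [hsum, centredSum, Finset.sum_sub_distrib, hfscore]
        simp only [Finset.sum_const, Finset.card_range, nsmul_eq_mul]
        field_simp
      rw [h2, abs_div, abs_of_pos hn', div_le_iff₀ hn', mul_comm]
      exact h1
    -- The score vanishes at `u = 0`, so the Lipschitz bound gives `|score| ≤ F` on the unit ball.
    · refine ⟨1 / n * ∑ i ∈ Finset.range n, -F (W i ω), Set.forall_mem_image.2 fun u hu => ?_⟩
      rw [hsum]
      gcongr with i
      have h1 := hlip _ (hω i) (θ, u) ⟨hθ, hu⟩ (θ, 0) ⟨hθ, by simp⟩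
      have h2 : ‖(θ, u) - (θ, (0 : Euc dφ))‖ ≤ 1 := by simpa [Prod.norm_def] using hu
      have h3 := h1.trans (mul_le_of_le_one_right (hF0 _) h2)
      rw [MissingGMM.score_zero, Pi.zero_apply, sub_zero] at h3
      simpa [hf, hω i] using (abs_le.1 h3).1
  have hlim : Tendsto (fun n : ℕ => ENNReal.ofReal (K * ((n : ℝ) ^ (-(1 / 2) : ℝ) / η n))) atTop
      (𝓝 0) := by
    have := ENNReal.tendsto_ofReal (hη_rate.tendsto_div_nhds_zero.const_mul K)
    simpa using this
  exact tendsto_of_tendsto_of_tendsto_of_le_of_le' tendsto_const_nhds hlim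
    (Eventually.of_forall fun _ => zero_le) hbound
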